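/- Let $R$ be a (not necessarily commutative) ring with identity, and let $\mathcal F$ be the class of all flat right $R$-modules. A left $R$-module $M$ is called $\mathcal F$-Mittag-Leffler if for every family $\{F_i : i\in I\}$ of flat right $R$-modules the canonical map $\left(\prod_{i\in I}F_i\right)\otimes_R M\to\prod_{i\in I}(F_i\otimes_R M)$ is injective; $\mathcal M^{\mathcal F}$ denotes the class of all such modules. A left $R$-module $M$ has $\mathcal M^{\mathcal F}$-projective dimension less than or equal to $m$ ($m\ge 0$ an integer) if some projective resolution of $M$ has its $(m-1)$-st syzygy in $\mathcal M^{\mathcal F}$, where the $(-1)$-st syzygy is $M$ itself and, for $k\ge 0$, the $k$-th syzygy of $\cdots\to P_1\to P_0\to M\to 0$ is the kernel of the map leaving $P_k$. The $\mathcal M^{\mathcal F}$-projective dimension of $M$ is the least such $m$ ($\infty$ if there is none), and the left global $\mathcal M^{\mathcal F}$-projective dimension of $R$ is the supremum of these dimensions over all left $R$-modules. Let $n$ be a nonzero natural number. Then the following are equivalent: 1. $R$ has left global $\mathcal M^{\mathcal F}$-projective dimension less than or equal to $n$. 2. Every left $R$-module has $\mathcal M^{\mathcal F}$-projective dimension less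 than or equal to $n$ (in the sense just defined, that is, some projective resolution of it has its $(n-1)$-st syzygy in $\mathcal M^{\mathcal F}$). 3. Every finitely generated left ideal of $R$ has $\mathcal M^{\mathcal F}$-projective dimension less than or equal to $n-1$ (in the same sense). -/

import Mathlib

open scoped TensorProduct

universe u v w v' w'

namespace RelDim

section Tensor

/-- The relations `(n r) ⊗ m - n ⊗ (r m)` inside `N ⊗[ℤ] M`, for a right `R`-module `N`
(that is, a module over `Rᵐᵒᵖ`) and a left `R`-module `M`. -/
def balanced (R : Type u) [Ring R] (N : Type v) [AddCommGroup N] [Module Rᵐᵒᵖ N]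
    (M : Type w) [AddCommGroup M] [Module R M] : Submodule ℤ (N ⊗[ℤ] M) :=
  Submodule.span ℤ
    {x | ∃ (n : N) (r : R) (m : M), x = (MulOpposite.op r • n) ⊗ₜ[ℤ] m - n ⊗ₜ[ℤ] (r • m)}

/-- The tensor product `N ⊗_R M` (an abelian group) of a right `R`-module `N` and a left
`R`-module `M` over a not necessarily commutative ring `R`. -/
abbrev Tensor (R : Type u) [Ring R] (N : Type v) [AddCommGroup N] [Module Rᵐᵒᵖ N]
    (M : Type w) [AddCommGroup M] [Module R M] : Type (max v w) :=
  (N ⊗[ℤ] M) ⧸ balanced R N M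

/-- The map `N ⊗_R f : N ⊗_R M → N ⊗_R M'` induced by a morphism `f` of left modules. -/
def Tensor.mapRight {R : Type u} [Ring R] (N : Type v) [AddCommGroup N] [Module Rᵐᵒᵖ N]
    {M : Type w} [AddCommGroup M] [Module R M] {M' : Type w'} [AddCommGroup M'] [Module R M']
    (f : M →ₗ[R] M') : Tensor R N M →ₗ[ℤ] Tensor R N M' :=
  Submodule.mapQ _ _ (LinearMap.lTensor N (f.restrictScalars ℤ)) (by
    refine Submodule.span_le.2 ?_
    rintro _ ⟨n, r, m, rfl⟩
    refine Submodule.subset_span ⟨n, r, f m, ?_⟩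
    change LinearMap.lTensor N (f.restrictScalars ℤ) _ = _
    simp [map_sub])

/-- The map `g ⊗_R M : N ⊗_R M → N' ⊗_R M` induced by a morphism `g` of right modules. -/
def Tensor.mapLeft {R : Type u} [Ring R] {N : Type v} [AddCommGroup N] [Module Rᵐᵒᵖ N]
    {N' : Type v'} [AddCommGroup N'] [Module Rᵐᵒᵖ N'] (M : Type w) [AddCommGroup M] [Module R M]
    (g : N →ₗ[Rᵐᵒᵖ] N') : Tensor R N M →ₗ[ℤ] Tensor R N' M :=
  Submodule.mapQ _ _ (LinearMap.rTensor M (g.restrictScalars ℤ)) (by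
    refine Submodule.span_le.2 ?_
    rintro _ ⟨n, r, m, rfl⟩
    refine Submodule.subset_span ⟨g n, r, m, ?_⟩
    change LinearMap.rTensor M (g.restrictScalars ℤ) _ = _
    simp [map_sub])

/-- The canonical map `(∏ i, F i) ⊗_R M → ∏ i, (F i ⊗_R M)`. -/
def Tensor.piMap (R : Type u) [Ring R] {ι : Type v'} (F : ι → Type v)
    [∀ i, AddCommGroup (F i)] [∀ i, Module Rᵐᵒᵖ (F i)] (M : Type w) [AddCommGroup M] [Module R M] :
    Tensor R (∀ i, F i) M →ₗ[ℤ] (∀ i, Tensor R (F i) M) :=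
  LinearMap.pi fun i => Tensor.mapLeft M (LinearMap.proj i)

end Tensor

/-- A right `R`-module `N` is flat if `N ⊗_R -` preserves monomorphisms of left `R`-modules. -/
def IsFlatRight (R : Type u) [Ring R] (N : Type u) [AddCommGroup N] [Module Rᵐᵒᵖ N] : Prop :=
  ∀ (M M' : Type u) [AddCommGroup M] [Module R M] [AddCommGroup M'] [Module R M']
    (f : M →ₗ[R] M'), Function.Injective f → Function.Injective (Tensor.mapRight N f)

/-- A left `R`-module `M` is `ℱ`-Mittag-Leffler, `ℱ` the class of all flat right `R`-modules, if
`(∏ i, F i) ⊗_R M → ∏ i, (F i ⊗_R M)` is injective for every family `F` of flat right modules. -/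
def flatMittagLeffler (R : Type u) [Ring R] (M : ModuleCat.{u} R) : Prop :=
  ∀ (ι : Type u) (F : ι → Type u) [∀ i, AddCommGroup (F i)] [∀ i, Module Rᵐᵒᵖ (F i)],
    (∀ i, IsFlatRight R (F i)) → Function.Injective (Tensor.piMap R F M)

/-- A projective resolution `⋯ → P 1 → P 0 → M → 0` of a left `R`-module `M`. -/
structure ProjRes {R : Type u} [Ring R] (M : ModuleCat.{u} R) where
  /-- the terms -/
  P : ℕ → ModuleCat.{u} R
  /-- the differentials -/
  d : ∀ k, P (k + 1) →ₗ[R] P k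
  /-- the augmentation -/
  aug : P 0 →ₗ[R] M
  projective : ∀ k, Module.Projective R (P k)
  aug_surjective : Function.Surjective aug
  exact_aug : Function.Exact (d 0) aug
  exact_d : ∀ k, Function.Exact (d (k + 1)) (d k)

/-- `Q.syzygy k` is the `(k - 1)`-st syzygy of the resolution: the `(-1)`-st syzygy is `M`, the
`0`-th is the kernel of `P 0 → M`, and the `(k + 1)`-st is the kernel of `P (k + 1) → P k`. -/
def ProjRes.syzygy {R : Type u} [Ring R] {M : ModuleCat.{u} R} (Q : ProjRes M) :
    ℕ → ModuleCat.{u} R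
  | 0 => M
  | 1 => ModuleCat.of R (LinearMap.ker Q.aug)
  | k + 2 => ModuleCat.of R (LinearMap.ker (Q.d k))

/-- `M` has projective dimension relative to the class `X` less than or equal to `n`: some
projective resolution of `M` has its `(n - 1)`-st syzygy in `X`. -/
def HasRelProjDimLE {R : Type u} [Ring R] (X : ModuleCat.{u} R → Prop) (M : ModuleCat.{u} R)
    (n : ℕ) : Prop :=
  ∃ Q : ProjRes M, X (Q.syzygy n)

/-- The `X`-projective dimension of `M`: the least `n` for which it is less than or equal to `n`,
and `∞` if there is none. -/
noncomputable def relProjDim {R : Type u} [Ring R] (X : ModuleCat.{u} R → Prop)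
    (M : ModuleCat.{u} R) : ℕ∞ :=
  ⨅ (n : ℕ) (_ : HasRelProjDimLE X M n), (n : ℕ∞)

/-- The left global `X`-projective dimension of `R`: the supremum of the `X`-projective dimensions
of all left `R`-modules. -/
noncomputable def relGlobalDim (R : Type u) [Ring R] (X : ModuleCat.{u} R → Prop) : ℕ∞ :=
  ⨆ M : ModuleCat.{u} R, relProjDim X M

end RelDim

/-! Let `0 → K → P → M → 0` be exact with `P` projective, and let the `F i` be flat right modules.
Since `(∏ F i) ⊗ P → ∏ (F i ⊗ P)` and every `F i ⊗ K → F i ⊗ P` are injective, `K` is Mittag-Leffler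
for the family iff `(∏ F i) ⊗ K → (∏ F i) ⊗ P` is injective, i.e. iff `Tor₁(∏ F i, M) = 0`
(`Tensor.piMap_injective_iff`, `torOneVanishes_iff`). Dimension shifting turns "dimension of `M` at
most `n + 1`" into `Tor₁(Ωⁿ(∏ F i), M) = 0`, where `Ωⁿ` is an iterated syzygy of right modules
(`hasRelProjDimLE_succ_iff`); the resolution of `M` has disappeared. An ideal `I` is a syzygy of `R
⧸ I`, so condition 3 says that these groups vanish at all `R ⧸ I` with `I` finitely generated. This
forces `Ωⁿ(∏ F i)` to be flat (`torOneVanishes_of_forall_fg`), which is condition 2. Condition 1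
bounds each module by its own `k ≤ n`; a finite product of counterexamples yields one `k` valid for
all modules, and such a uniform bound can be raised to `n`. -/

namespace RelDim

namespace Tensor

/-! ### Tensor products over a noncommutative ring: functoriality and right exactness. -/

section Basic

variable {R : Type u} [Ring R] {N : Type v} [AddCommGroup N] [Module Rᵐᵒᵖ N]
  {N' : Type v'} [AddCommGroup N'] [Module Rᵐᵒᵖ N']
  {M : Type w} [AddCommGroup M] [Module R M] {M' : Type w'} [AddCommGroup M'] [Module R M']

/-- The pure tensor `n ⊗ m` in `N ⊗_R M`. -/
def tmul (R : Type u) [Ring R] {N : Type v} [AddCommGroup N] [Module Rᵐᵒᵖ N]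
    {M : Type w} [AddCommGroup M] [Module R M] (n : N) (m : M) : Tensor R N M :=
  Submodule.Quotient.mk (n ⊗ₜ[ℤ] m)

theorem tmul_add (n : N) (m m' : M) : tmul R n (m + m') = tmul R n m + tmul R n m' := by
  simp [tmul, TensorProduct.tmul_add]

theorem tmul_zero (n : N) : tmul R n (0 : M) = 0 := by
  simp [tmul]

theorem add_tmul (n n' : N) (m : M) : tmul R (n + n') m = tmul R n m + tmul R n' m := by
  simp [tmul, TensorProduct.add_tmul]

theorem zero_tmul (m : M) : tmul R (0 : N) m = 0 := by
  simp [tmul]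

theorem smul_tmul (r : R) (n : N) (m : M) :
    tmul R (MulOpposite.op r • n) m = tmul R n (r • m) :=
  (Submodule.Quotient.eq _).2 (Submodule.subset_span ⟨n, r, m, rfl⟩)

@[simp] theorem mapRight_tmul (f : M →ₗ[R] M') (n : N) (m : M) :
    mapRight N f (tmul R n m) = tmul R n (f m) := rfl

@[simp] theorem mapLeft_tmul (g : N →ₗ[Rᵐᵒᵖ] N') (n : N) (m : M) :
    mapLeft M g (tmul R n m) = tmul R (g n) m := rfl

@[elab_as_elim]
theorem induction_on {p : Tensor R N M → Prop} (x : Tensor R N M) (zero : p 0)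
    (tmul : ∀ n m, p (tmul R n m)) (add : ∀ x y, p x → p y → p (x + y)) : p x := by
  obtain ⟨z, rfl⟩ := Submodule.Quotient.mk_surjective _ x
  induction z using TensorProduct.induction_on with
  | zero => exact zero
  | tmul n m => exact tmul n m
  | add a b ha hb => exact add _ _ ha hb

theorem hom_ext {A : Type*} [AddCommGroup A] {f g : Tensor R N M →ₗ[ℤ] A}
    (h : ∀ n m, f (tmul R n m) = g (tmul R n m)) : f = g := by
  refine LinearMap.ext fun x => ?_
  induction x using Tensor.induction_on with
  | zero => simp
  | tmul n m => exact h n m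
  | add a b ha hb => rw [map_add, map_add, ha, hb]

/-- The map out of `N ⊗_R M` given by a balanced biadditive map. -/
def lift {A : Type*} [AddCommGroup A] (b : N →+ M →+ A)
    (hb : ∀ n (r : R) m, b (MulOpposite.op r • n) m = b n (r • m)) : Tensor R N M →ₗ[ℤ] A :=
  Submodule.liftQ _ (TensorProduct.liftAddHom b fun c n m => by simp).toIntLinearMap (by
    refine Submodule.span_le.2 ?_
    rintro _ ⟨n, r, m, rfl⟩
    rw [SetLike.mem_coe, LinearMap.mem_ker, AddMonoidHom.coe_toIntLinearMap, map_sub]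
    simp only [TensorProduct.liftAddHom_tmul, hb, sub_self])

@[simp] theorem lift_tmul {A : Type*} [AddCommGroup A] (b : N →+ M →+ A)
    (hb : ∀ n (r : R) m, b (MulOpposite.op r • n) m = b n (r • m)) (n : N) (m : M) :
    lift b hb (tmul R n m) = b n m :=
  rfl

theorem mapLeft_mapRight (f : M →ₗ[R] M') (g : N →ₗ[Rᵐᵒᵖ] N') (x : Tensor R N M) :
    mapLeft M' g (mapRight N f x) = mapRight N' f (mapLeft M g x) :=
  LinearMap.congr_fun (hom_ext (f := mapLeft M' g ∘ₗ mapRight N f)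
    (g := mapRight N' f ∘ₗ mapLeft M g) fun _ _ => rfl) x

theorem mapRight_comp {M'' : Type*} [AddCommGroup M''] [Module R M''] (f : M →ₗ[R] M')
    (f' : M' →ₗ[R] M'') (x : Tensor R N M) :
    mapRight N f' (mapRight N f x) = mapRight N (f' ∘ₗ f) x :=
  LinearMap.congr_fun (hom_ext (f := mapRight N f' ∘ₗ mapRight N f)
    (g := mapRight N (f' ∘ₗ f)) fun _ _ => rfl) x

theorem mapRight_id (x : Tensor R N M) : mapRight N (LinearMap.id : M →ₗ[R] M) x = x :=
  LinearMap.congr_fun (hom_ext (f := mapRight N (LinearMap.id : M →ₗ[R] M))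
    (g := LinearMap.id) fun _ _ => rfl) x

theorem mapRight_injective_of_leftInverse {s : M →ₗ[R] M'} {t : M' →ₗ[R] M}
    (h : t ∘ₗ s = LinearMap.id) : Function.Injective (mapRight N s) :=
  Function.LeftInverse.injective (g := mapRight N t) fun x => by
    rw [mapRight_comp, h, mapRight_id]

theorem mapRight_surjective {f : M →ₗ[R] M'} (hf : Function.Surjective f) :
    Function.Surjective (mapRight N f) := by
  intro x
  obtain ⟨z, rfl⟩ := Submodule.Quotient.mk_surjective _ x
  obtain ⟨y, rfl⟩ := LinearMap.lTensor_surjective N (g := f.restrictScalars ℤ) hf z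
  exact ⟨Submodule.Quotient.mk y, rfl⟩

theorem mapLeft_surjective {g : N →ₗ[Rᵐᵒᵖ] N'} (hg : Function.Surjective g) :
    Function.Surjective (mapLeft M g) := by
  intro x
  obtain ⟨z, rfl⟩ := Submodule.Quotient.mk_surjective _ x
  obtain ⟨y, rfl⟩ := LinearMap.rTensor_surjective M (g := g.restrictScalars ℤ) hg z
  exact ⟨Submodule.Quotient.mk y, rfl⟩

theorem exact_mapRight {M'' : Type*} [AddCommGroup M''] [Module R M''] {f : M →ₗ[R] M'}
    {g : M' →ₗ[R] M''} (h : Function.Exact f g) (hg : Function.Surjective g) :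
    Function.Exact (mapRight N f) (mapRight N g) := by
  intro x
  constructor
  · intro hx
    obtain ⟨z, rfl⟩ := Submodule.Quotient.mk_surjective _ x
    have hz : LinearMap.lTensor N (g.restrictScalars ℤ) z ∈ balanced R N M'' :=
      (Submodule.Quotient.mk_eq_zero _).1 hx
    -- Surjectivity of `g` lifts the balancing relations, so subtracting a lift `b` moves `z` into
    -- the kernel over `ℤ`, where exactness is known.
    have hle : balanced R N M'' ≤
        (balanced R N M').map (LinearMap.lTensor N (g.restrictScalars ℤ)) := by
      refine Submodule.span_le.2 ?_
      rintro _ ⟨n, r, m, rfl⟩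
      obtain ⟨m, rfl⟩ := hg m
      exact ⟨_, Submodule.subset_span ⟨n, r, m, rfl⟩, by simp [map_sub]⟩
    obtain ⟨b, hb, hbz⟩ := hle hz
    have hex := lTensor_exact N (f := f.restrictScalars ℤ) (g := g.restrictScalars ℤ) h hg
    obtain ⟨y, hy⟩ := (hex (z - b)).1 (by rw [map_sub, hbz, sub_self])
    refine ⟨Submodule.Quotient.mk y, ?_⟩
    change Submodule.Quotient.mk (LinearMap.lTensor N (f.restrictScalars ℤ) y) = _
    rw [hy]
    refine (Submodule.Quotient.eq _).2 ?_
    rw [sub_sub_cancel_left]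
    exact neg_mem hb
  · rintro ⟨y, rfl⟩
    rw [mapRight_comp, h.linearMap_comp_eq_zero]
    induction y using Tensor.induction_on with
    | zero => simp
    | tmul n m => simp [tmul_zero]
    | add a b ha hb => rw [map_add, ha, hb, add_zero]

theorem exact_mapLeft {N'' : Type*} [AddCommGroup N''] [Module Rᵐᵒᵖ N''] {f : N →ₗ[Rᵐᵒᵖ] N'}
    {g : N' →ₗ[Rᵐᵒᵖ] N''} (h : Function.Exact f g) (hg : Function.Surjective g) :
    Function.Exact (mapLeft M f) (mapLeft M g) := by
  intro x
  constructor
  · intro hx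
    obtain ⟨z, rfl⟩ := Submodule.Quotient.mk_surjective _ x
    have hz : LinearMap.rTensor M (g.restrictScalars ℤ) z ∈ balanced R N'' M :=
      (Submodule.Quotient.mk_eq_zero _).1 hx
    have hle : balanced R N'' M ≤
        (balanced R N' M).map (LinearMap.rTensor M (g.restrictScalars ℤ)) := by
      refine Submodule.span_le.2 ?_
      rintro _ ⟨n, r, m, rfl⟩
      obtain ⟨n, rfl⟩ := hg n
      exact ⟨_, Submodule.subset_span ⟨n, r, m, rfl⟩, by simp [map_sub]⟩
    obtain ⟨b, hb, hbz⟩ := hle hz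
    have hex := rTensor_exact M (f := f.restrictScalars ℤ) (g := g.restrictScalars ℤ) h hg
    obtain ⟨y, hy⟩ := (hex (z - b)).1 (by rw [map_sub, hbz, sub_self])
    refine ⟨Submodule.Quotient.mk y, ?_⟩
    change Submodule.Quotient.mk (LinearMap.rTensor M (f.restrictScalars ℤ) y) = _
    rw [hy]
    refine (Submodule.Quotient.eq _).2 ?_
    rw [sub_sub_cancel_left]
    exact neg_mem hb
  · rintro ⟨y, rfl⟩
    induction y using Tensor.induction_on with
    | zero => simp
    | tmul n m => simp [h.apply_apply_eq_zero, zero_tmul]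
    | add a b ha hb => rw [map_add, map_add, ha, hb, add_zero]

/-- A tensor in `N ⊗_R M` comes from a finitely generated submodule of `M`. -/
theorem exists_fg_mapRight_subtype (x : Tensor R N M) :
    ∃ A : Submodule R M, A.FG ∧ ∃ y : Tensor R N A, mapRight N A.subtype y = x := by
  induction x using Tensor.induction_on with
  | zero => exact ⟨⊥, Submodule.fg_bot, 0, map_zero _⟩
  | tmul n m =>
    exact ⟨Submodule.span R {m}, Submodule.fg_span_singleton m,
      tmul R n ⟨m, Submodule.mem_span_singleton_self m⟩, rfl⟩
  | add a b ha hb =>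
    obtain ⟨A, hA, y, rfl⟩ := ha
    obtain ⟨B, hB, z, rfl⟩ := hb
    refine ⟨A ⊔ B, hA.sup hB, mapRight N (Submodule.inclusion le_sup_left) y +
      mapRight N (Submodule.inclusion le_sup_right) z, ?_⟩
    rw [map_add, mapRight_comp, mapRight_comp]
    rfl

end Basic

/-! ### Free modules: coordinates, and flatness of free and projective modules. -/

section Free

variable {R : Type u} [Ring R] (J : Type*)

/-- The map `N ⊗_R R^(J) → N^(J)`. -/
noncomputable def toFinsuppRight (N : Type v) [AddCommGroup N] [Module Rᵐᵒᵖ N] :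
    Tensor R N (J →₀ R) →ₗ[ℤ] (J →₀ N) :=
  lift (AddMonoidHom.mk' (fun n => AddMonoidHom.mk'
      (fun f : J →₀ R => f.mapRange (fun r => MulOpposite.op r • n) (by simp))
      (fun _ _ => by ext; simp [add_smul])) fun _ _ => by ext; simp)
    fun _ _ _ => by ext; simp [mul_smul]

/-- The map `(R^(J)) ⊗_R M → M^(J)`, where `R^(J)` is the free right module. -/
noncomputable def toFinsuppLeft (M : Type w) [AddCommGroup M] [Module R M] :
    Tensor R (J →₀ Rᵐᵒᵖ) M →ₗ[ℤ] (J →₀ M) :=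
  lift (AddMonoidHom.mk' (fun f : J →₀ Rᵐᵒᵖ => AddMonoidHom.mk'
      (fun m => f.mapRange (fun r => MulOpposite.unop r • m) (by simp))
      (fun _ _ => by ext; simp)) fun _ _ => by ext; simp [add_smul])
    fun _ _ _ => by ext; simp [mul_smul]

variable {J}

theorem toFinsuppRight_tmul_single {N : Type v} [AddCommGroup N] [Module Rᵐᵒᵖ N] (n : N) (j : J)
    (r : R) : toFinsuppRight J N (tmul R n (Finsupp.single j r)) =
      Finsupp.single j (MulOpposite.op r • n) := by
  simp [toFinsuppRight]

theorem toFinsuppLeft_tmul_single {M : Type w} [AddCommGroup M] [Module R M] (m : M) (j : J)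
    (r : Rᵐᵒᵖ) : toFinsuppLeft J M (tmul R (Finsupp.single j r) m) =
      Finsupp.single j (MulOpposite.unop r • m) := by
  simp [toFinsuppLeft]

theorem induction_on_finsuppRight {N : Type v} [AddCommGroup N] [Module Rᵐᵒᵖ N]
    {p : Tensor R N (J →₀ R) → Prop} (x : Tensor R N (J →₀ R)) (zero : p 0)
    (tmul : ∀ n j r, p (tmul R n (Finsupp.single j r)))
    (add : ∀ x y, p x → p y → p (x + y)) : p x := by
  induction x using Tensor.induction_on with
  | zero => exact zero
  | tmul n f =>
    induction f using Finsupp.induction_linear with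
    | zero => rwa [tmul_zero]
    | add f g hf hg => rw [tmul_add]; exact add _ _ hf hg
    | single j r => exact tmul n j r
  | add a b ha hb => exact add _ _ ha hb

theorem induction_on_finsuppLeft {M : Type w} [AddCommGroup M] [Module R M]
    {p : Tensor R (J →₀ Rᵐᵒᵖ) M → Prop} (x : Tensor R (J →₀ Rᵐᵒᵖ) M) (zero : p 0)
    (tmul : ∀ j r m, p (tmul R (Finsupp.single j r) m))
    (add : ∀ x y, p x → p y → p (x + y)) : p x := by
  induction x using Tensor.induction_on with
  | zero => exact zero
  | tmul f n =>
    induction f using Finsupp.induction_linear with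
    | zero => rwa [zero_tmul]
    | add f g hf hg => rw [add_tmul]; exact add _ _ hf hg
    | single j r => exact tmul j r n
  | add a b ha hb => exact add _ _ ha hb

theorem toFinsuppRight_injective (N : Type v) [AddCommGroup N] [Module Rᵐᵒᵖ N] :
    Function.Injective (toFinsuppRight (R := R) J N) := by
  let ψ : (J →₀ N) →+ Tensor R N (J →₀ R) := Finsupp.liftAddHom fun j =>
    { toFun := fun n => tmul R n (Finsupp.single j 1)
      map_zero' := zero_tmul _
      map_add' := fun _ _ => add_tmul _ _ _ }
  have hψ : ∀ j n, ψ (Finsupp.single j n) = tmul R n (Finsupp.single j 1) := fun j n =>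
    Finsupp.liftAddHom_apply_single _ _ _
  refine Function.LeftInverse.injective (g := ψ) fun x => ?_
  induction x using induction_on_finsuppRight with
  | zero => simp
  | tmul n j r => simp [toFinsuppRight_tmul_single, hψ, smul_tmul]
  | add a b ha hb => rw [map_add, map_add, ha, hb]

theorem toFinsuppLeft_injective (M : Type w) [AddCommGroup M] [Module R M] :
    Function.Injective (toFinsuppLeft (R := R) J M) := by
  let ψ : (J →₀ M) →+ Tensor R (J →₀ Rᵐᵒᵖ) M := Finsupp.liftAddHom fun j =>
    { toFun := fun m => tmul R (Finsupp.single j 1) m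
      map_zero' := tmul_zero _
      map_add' := fun _ _ => tmul_add _ _ _ }
  have hψ : ∀ j m, ψ (Finsupp.single j m) = tmul R (Finsupp.single j 1) m := fun j m =>
    Finsupp.liftAddHom_apply_single _ _ _
  refine Function.LeftInverse.injective (g := ψ) fun x => ?_
  induction x using induction_on_finsuppLeft with
  | zero => simp
  | tmul j r m => simp [toFinsuppLeft_tmul_single, hψ, ← smul_tmul]
  | add a b ha hb => rw [map_add, map_add, ha, hb]

/-- A free right module is flat. -/
theorem mapRight_injective_of_free {M : Type w} [AddCommGroup M] [Module R M] {M' : Type w'}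
    [AddCommGroup M'] [Module R M'] {f : M →ₗ[R] M'} (hf : Function.Injective f) :
    Function.Injective (mapRight (J →₀ Rᵐᵒᵖ) f) := by
  have key : ∀ x, toFinsuppLeft J M' (mapRight (J →₀ Rᵐᵒᵖ) f x) =
      Finsupp.mapRange f (map_zero f) (toFinsuppLeft J M x) := by
    intro x
    induction x using induction_on_finsuppLeft with
    | zero => simp
    | tmul j r m => simp [toFinsuppLeft_tmul_single]
    | add a b ha hb => simp [ha, hb, Finsupp.mapRange_add]
  intro x y hxy
  apply toFinsuppLeft_injective M
  apply Finsupp.mapRange_injective f (map_zero f) hf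
  rw [← key, ← key, hxy]

/-- A projective left module is flat. -/
theorem mapLeft_injective_of_projective {N : Type v} [AddCommGroup N] [Module Rᵐᵒᵖ N]
    {N' : Type v'} [AddCommGroup N'] [Module Rᵐᵒᵖ N'] {g : N →ₗ[Rᵐᵒᵖ] N'}
    (hg : Function.Injective g) (P : Type w) [AddCommGroup P] [Module R P]
    [hP : Module.Projective R P] : Function.Injective (mapLeft P g) := by
  obtain ⟨s, hs⟩ := hP.out
  have key : ∀ x, toFinsuppRight P N' (mapLeft (P →₀ R) g x) =
      Finsupp.mapRange g (map_zero g) (toFinsuppRight P N x) := by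
    intro x
    induction x using induction_on_finsuppRight with
    | zero => simp
    | tmul n j r => simp [toFinsuppRight_tmul_single]
    | add a b ha hb => simp [ha, hb, Finsupp.mapRange_add]
  intro x y hxy
  apply mapRight_injective_of_leftInverse (s := s) (t := Finsupp.linearCombination R id)
    (LinearMap.ext hs)
  apply toFinsuppRight_injective N
  apply Finsupp.mapRange_injective g (map_zero g) hg
  rw [← key, ← key, mapLeft_mapRight, mapLeft_mapRight, hxy]

end Free

/-! ### The canonical map for products. -/

section Pi

variable {R : Type u} [Ring R] {ι : Type v'} (F : ι → Type v) [∀ i, AddCommGroup (F i)]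
  [∀ i, Module Rᵐᵒᵖ (F i)]

theorem piMap_apply (M : Type w) [AddCommGroup M] [Module R M] (x : Tensor R (∀ i, F i) M)
    (i : ι) : piMap R F M x i = mapLeft M (LinearMap.proj (R := Rᵐᵒᵖ) (φ := F) i) x := rfl

theorem piMap_mapRight {M : Type w} [AddCommGroup M] [Module R M] {M' : Type w'}
    [AddCommGroup M'] [Module R M'] (f : M →ₗ[R] M') (x : Tensor R (∀ i, F i) M) (i : ι) :
    piMap R F M' (mapRight _ f x) i = mapRight (F i) f (piMap R F M x i) := by
  rw [piMap_apply, piMap_apply, mapLeft_mapRight]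

theorem piMap_injective_of_leftInverse {M : Type w} [AddCommGroup M] [Module R M] {M' : Type w'}
    [AddCommGroup M'] [Module R M'] {s : M →ₗ[R] M'} {t : M' →ₗ[R] M}
    (h : t ∘ₗ s = LinearMap.id) (hM' : Function.Injective (piMap R F M')) :
    Function.Injective (piMap R F M) := by
  intro x y hxy
  apply mapRight_injective_of_leftInverse h
  apply hM'
  ext i
  rw [piMap_mapRight, piMap_mapRight, hxy]

/-- A projective module is a retract of a free one, and for a free module the map is, in
coordinates, the inclusion of `(∏ F i)^(J)` in `∏ (F i)^(J)`. -/
theorem piMap_injective_of_projective (P : Type w) [AddCommGroup P] [Module R P]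
    [hP : Module.Projective R P] : Function.Injective (piMap R F P) := by
  obtain ⟨s, hs⟩ := hP.out
  refine piMap_injective_of_leftInverse F (t := Finsupp.linearCombination R id)
    (LinearMap.ext hs) ?_
  have key : ∀ x i p, toFinsuppRight P (∀ i, F i) x p i =
      toFinsuppRight P (F i) (piMap R F (P →₀ R) x i) p := by
    intro x i p
    induction x using induction_on_finsuppRight with
    | zero => simp
    | tmul n j r =>
      change _ = toFinsuppRight P (F i) (tmul R (n i) (Finsupp.single j r)) p
      rw [toFinsuppRight_tmul_single, toFinsuppRight_tmul_single]
      by_cases h : j = p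
      · subst h; simp
      · simp [Finsupp.single_eq_of_ne' h]
    | add a b ha hb => simp [ha, hb]
  intro x y hxy
  apply toFinsuppRight_injective
  ext p i
  rw [key, key, hxy]

/-- For a submodule of a projective module, the injectivity of the canonical map for a family of
flat modules is the injectivity of the inclusion after tensoring with the product. -/
theorem piMap_injective_iff {K : Type w} [AddCommGroup K] [Module R K] {P : Type w}
    [AddCommGroup P] [Module R P] [Module.Projective R P] (f : K →ₗ[R] P)
    (hF : ∀ i, Function.Injective (mapRight (F i) f)) :
    Function.Injective (piMap R F K) ↔ Function.Injective (mapRight (∀ i, F i) f) := by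
  -- In the naturality square of `piMap` along `f`, the edge at `P` is injective by projectivity and
  -- the edge between the products by `hF`; hence the other two edges are injective together.
  constructor
  · intro h x y hxy
    apply h
    ext i
    apply hF i
    rw [← piMap_mapRight, ← piMap_mapRight, hxy]
  · intro h x y hxy
    apply h
    apply piMap_injective_of_projective F P
    ext i
    rw [piMap_mapRight, piMap_mapRight, hxy]

end Pi

end Tensor

/-- In a three by three diagram with right exact rows and columns, whose middle row is left exact,
the injectivity in the last column implies the injectivity in the last row. -/
theorem grid_injective {A₁ A₂ A₃ B₁ B₂ B₃ C₁ C₂ : Type*} [AddCommGroup A₁] [AddCommGroup A₂]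
    [AddCommGroup A₃] [AddCommGroup B₁] [AddCommGroup B₂] [AddCommGroup B₃] [AddCommGroup C₁]
    [AddCommGroup C₂] {a : A₁ →ₗ[ℤ] A₂} {b : A₂ →ₗ[ℤ] A₃} {c : B₁ →ₗ[ℤ] B₂} {d : B₂ →ₗ[ℤ] B₃}
    {e : C₁ →ₗ[ℤ] C₂} {v₁ : A₁ →ₗ[ℤ] B₁} {v₂ : A₂ →ₗ[ℤ] B₂} {v₃ : A₃ →ₗ[ℤ] B₃}
    {w₁ : B₁ →ₗ[ℤ] C₁} {w₂ : B₂ →ₗ[ℤ] C₂} (hab : Function.Exact a b) (hcd : Function.Exact c d)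
    (hv₁ : Function.Exact v₁ w₁) (hv₂ : Function.Exact v₂ w₂) (hw₁ : Function.Surjective w₁)
    (hc : Function.Injective c) (h₁ : ∀ x, c (v₁ x) = v₂ (a x)) (h₂ : ∀ x, e (w₁ x) = w₂ (c x))
    (h₃ : ∀ x, d (v₂ x) = v₃ (b x)) (hv₃ : Function.Injective v₃) : Function.Injective e := by
  refine (injective_iff_map_eq_zero e).2 fun x hx => ?_
  obtain ⟨y, rfl⟩ := hw₁ x
  rw [h₂] at hx
  obtain ⟨z, hz⟩ := (hv₂ _).1 hx
  have hbz : b z = 0 := by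
    apply hv₃
    rw [← h₃, hz, hcd.apply_apply_eq_zero, map_zero]
  obtain ⟨t, rfl⟩ := (hab _).1 hbz
  rw [← h₁] at hz
  rw [← hc hz, hv₁.apply_apply_eq_zero]

/-! ### Canonical free covers and their syzygies. -/

section FreeSyzygy

variable {S : Type u} [Ring S]

/-- The canonical map from a free module onto `N`. -/
noncomputable def freeCover (N : ModuleCat.{u} S) : (N →₀ S) →ₗ[S] N :=
  Finsupp.linearCombination S id

/-- The kernel of the canonical map from a free module onto `N`. -/
noncomputable def freeSyzygy (N : ModuleCat.{u} S) : ModuleCat.{u} S :=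
  ModuleCat.of S (LinearMap.ker (freeCover N))

/-- The inclusion of the kernel of the canonical map from a free module onto `N`. -/
noncomputable def freeSyzygyι (N : ModuleCat.{u} S) : freeSyzygy N →ₗ[S] (N →₀ S) :=
  (LinearMap.ker (freeCover N)).subtype

theorem freeCover_surjective (N : ModuleCat.{u} S) : Function.Surjective (freeCover N) :=
  Finsupp.linearCombination_id_surjective S N

theorem freeSyzygyι_injective (N : ModuleCat.{u} S) : Function.Injective (freeSyzygyι N) :=
  Submodule.subtype_injective _

theorem exact_freeSyzygyι_freeCover (N : ModuleCat.{u} S) :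
    Function.Exact (freeSyzygyι N) (freeCover N) :=
  LinearMap.exact_subtype_ker_map _

/-- The `n`-fold iterate of `freeSyzygy`. -/
noncomputable def iterFreeSyzygy (N : ModuleCat.{u} S) : ℕ → ModuleCat.{u} S
  | 0 => N
  | n + 1 => freeSyzygy (iterFreeSyzygy N n)

end FreeSyzygy

/-! ### First torsion groups: balancing, dimension shifting, flatness test. -/

section TorOne

variable {R : Type u} [Ring R]

/-- The vanishing of the first torsion group of `N` and `M`. -/
def TorOneVanishes (N : ModuleCat.{u} Rᵐᵒᵖ) (M : Type w) [AddCommGroup M] [Module R M] : Prop :=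
  Function.Injective (Tensor.mapLeft (R := R) M (freeSyzygyι N))

variable {K : Type v} [AddCommGroup K] [Module R K] {P : Type v'} [AddCommGroup P] [Module R P]
  {M : Type w} [AddCommGroup M] [Module R M] {f : K →ₗ[R] P} {g : P →ₗ[R] M}

/-- One half of the balancing of Tor. The middle row of the grid is the free cover of `N` tensored
with `f`, so `P` may be arbitrary. -/
theorem TorOneVanishes.mapRight_injective {N : ModuleCat.{u} Rᵐᵒᵖ} (h : TorOneVanishes N M)
    (hf : Function.Injective f) (hfg : Function.Exact f g) (hg : Function.Surjective g) :
    Function.Injective (Tensor.mapRight N f) := by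
  have hN := freeCover_surjective N
  have hL := exact_freeSyzygyι_freeCover N
  exact grid_injective (Tensor.exact_mapRight hfg hg) (Tensor.exact_mapRight hfg hg)
    (Tensor.exact_mapLeft hL hN) (Tensor.exact_mapLeft hL hN) (Tensor.mapLeft_surjective hN)
    (Tensor.mapRight_injective_of_free hf) (fun x => (Tensor.mapLeft_mapRight f _ x).symm)
    (fun x => (Tensor.mapLeft_mapRight f _ x).symm)
    (fun x => (Tensor.mapLeft_mapRight g _ x).symm) h

/-- The converse transposes the grid; its middle row is now injective because `P` is flat. -/
theorem torOneVanishes_iff [Module.Projective R P] (N : ModuleCat.{u} Rᵐᵒᵖ)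
    (hf : Function.Injective f) (hfg : Function.Exact f g) (hg : Function.Surjective g) :
    TorOneVanishes N M ↔ Function.Injective (Tensor.mapRight N f) := by
  refine ⟨fun h => h.mapRight_injective hf hfg hg, fun h => ?_⟩
  have hN := freeCover_surjective N
  have hL := exact_freeSyzygyι_freeCover N
  exact grid_injective (Tensor.exact_mapLeft hL hN) (Tensor.exact_mapLeft hL hN)
    (Tensor.exact_mapRight hfg hg) (Tensor.exact_mapRight hfg hg) (Tensor.mapRight_surjective hg)
    (Tensor.mapLeft_injective_of_projective (freeSyzygyι_injective N) P)
    (fun x => Tensor.mapLeft_mapRight f _ x) (fun x => Tensor.mapLeft_mapRight g _ x)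
    (fun x => Tensor.mapLeft_mapRight f _ x) h

/-- Dimension shifting. -/
theorem torOneVanishes_freeSyzygy_iff [Module.Projective R P] (N : ModuleCat.{u} Rᵐᵒᵖ)
    (hf : Function.Injective f) (hfg : Function.Exact f g) (hg : Function.Surjective g) :
    TorOneVanishes (freeSyzygy N) M ↔ TorOneVanishes N K := by
  rw [torOneVanishes_iff (freeSyzygy N) hf hfg hg]
  -- Both conditions become injectivity of the same map from `freeSyzygy N ⊗ K` to the free cover of
  -- `N` tensored with `P`.
  have hP := Tensor.mapLeft_injective_of_projective (R := R) (freeSyzygyι_injective N) P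
  have hQ := Tensor.mapRight_injective_of_free (R := R) (J := N) hf
  have comm := Tensor.mapLeft_mapRight f (freeSyzygyι N)
  constructor
  · intro h x y hxy
    apply h
    apply hP
    exact (comm x).trans ((congrArg _ hxy).trans (comm y).symm)
  · intro h x y hxy
    apply h
    apply hQ
    exact (comm x).symm.trans ((congrArg _ hxy).trans (comm y))

theorem TorOneVanishes.of_leftInverse {N : ModuleCat.{u} Rᵐᵒᵖ} {s : M →ₗ[R] P} {t : P →ₗ[R] M}
    (hst : t ∘ₗ s = LinearMap.id) (h : TorOneVanishes N P) : TorOneVanishes N M := by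
  refine fun x y hxy => ?_
  apply Tensor.mapRight_injective_of_leftInverse hst
  apply h
  rw [Tensor.mapLeft_mapRight, Tensor.mapLeft_mapRight, hxy]

theorem TorOneVanishes.of_exact {N : ModuleCat.{u} Rᵐᵒᵖ} (hf : Function.Injective f)
    (hfg : Function.Exact f g) (hg : Function.Surjective g) (hK : TorOneVanishes N K)
    (hM : TorOneVanishes N M) : TorOneVanishes N P := by
  refine (injective_iff_map_eq_zero (Tensor.mapLeft P (freeSyzygyι N))).2 fun x hx => ?_
  have hx' : Tensor.mapRight _ g x = 0 := by
    apply hM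
    rw [Tensor.mapLeft_mapRight, hx, map_zero, map_zero]
  obtain ⟨y, rfl⟩ := (Tensor.exact_mapRight hfg hg x).1 hx'
  rw [Tensor.mapLeft_mapRight] at hx
  have hy := (injective_iff_map_eq_zero _).1 (Tensor.mapRight_injective_of_free hf) _ hx
  rw [(injective_iff_map_eq_zero _).1 hK y hy, map_zero]

variable {N : ModuleCat.{u} Rᵐᵒᵖ}

/-- A tensor in the kernel already lives over a finitely generated subideal, where the hypothesis
applies. -/
theorem mapRight_ideal_subtype_injective
    (h : ∀ I : Ideal R, I.FG → TorOneVanishes N (R ⧸ I)) (I : Ideal R) :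
    Function.Injective (Tensor.mapRight N (Submodule.subtype I)) := by
  refine (injective_iff_map_eq_zero _).2 fun x hx => ?_
  obtain ⟨A, hA, y, rfl⟩ := Tensor.exists_fg_mapRight_subtype x
  let e := Submodule.equivSubtypeMap I A
  have hI := (h _ (hA.map I.subtype)).mapRight_injective (Submodule.subtype_injective _)
    (LinearMap.exact_subtype_mkQ (A.map I.subtype)) (Submodule.mkQ_surjective _)
  have he : Function.Injective (Tensor.mapRight N e.toLinearMap) :=
    Tensor.mapRight_injective_of_leftInverse (t := e.symm.toLinearMap) (by ext; simp)
  have hy : y = 0 := by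
    apply he
    apply hI
    rw [map_zero, map_zero, Tensor.mapRight_comp]
    rw [Tensor.mapRight_comp] at hx
    exact hx
  rw [hy, map_zero]

/-- If the torsion of `N` with `R ⧸ I` vanishes for every finitely generated left ideal `I`, then
`N` is flat. -/
theorem torOneVanishes_of_forall_fg
    (h : ∀ I : Ideal R, I.FG → TorOneVanishes N (R ⧸ I)) (M : Type w) [AddCommGroup M]
    [Module R M] : TorOneVanishes N M := by
  -- Cyclic modules are quotients of `R` by ideals; adjoining one generator at a time is an
  -- extension by a cyclic module; a general `M` is reached through its finitely generated
  -- submodules.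
  have cyclic : ∀ {C : Type w} [AddCommGroup C] [Module R C] (g : R →ₗ[R] C),
      Function.Surjective g → TorOneVanishes N C := fun g hg =>
    (torOneVanishes_iff N (Submodule.subtype_injective _) (LinearMap.exact_subtype_ker_map g)
      hg).2 (mapRight_ideal_subtype_injective h _)
  have span : ∀ s : Finset M, TorOneVanishes N (Submodule.span R (s : Set M)) := by
    classical
    intro s
    induction s using Finset.induction_on with
    | empty =>
      refine cyclic 0 ?_
      rintro ⟨x, hx⟩
      refine ⟨0, Subtype.ext ?_⟩
      rw [Finset.coe_empty, Submodule.span_empty, Submodule.mem_bot] at hx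
      exact hx.symm
    | insert a s _ ih =>
      have hle : Submodule.span R (s : Set M) ≤ Submodule.span R (insert a s : Finset M) :=
        Submodule.span_mono (by simp)
      have ha : a ∈ Submodule.span R ((insert a s : Finset M) : Set M) :=
        Submodule.subset_span (by simp)
      let q := ((Submodule.span R (s : Set M)).submoduleOf
        (Submodule.span R (insert a s : Finset M))).mkQ
      refine TorOneVanishes.of_exact (f := Submodule.inclusion hle) (g := q)
        (Submodule.inclusion_injective hle) ?_ (Submodule.mkQ_surjective _) ih
        (cyclic (q ∘ₗ LinearMap.toSpanSingleton R _ ⟨a, ha⟩) ?_)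
      · intro x
        rw [Submodule.mkQ_apply, Submodule.Quotient.mk_eq_zero, Submodule.submoduleOf,
          Submodule.mem_comap]
        exact ⟨fun hx => ⟨⟨x, hx⟩, rfl⟩, by rintro ⟨y, rfl⟩; exact y.2⟩
      · intro y
        obtain ⟨⟨x, hx⟩, rfl⟩ := Submodule.mkQ_surjective _ y
        have hx' := hx
        rw [Finset.coe_insert, Submodule.mem_span_insert] at hx'
        obtain ⟨r, z, hz, rfl⟩ := hx'
        refine ⟨r, (Submodule.Quotient.eq _).2 ?_⟩
        rw [Submodule.submoduleOf, Submodule.mem_comap]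
        simpa using hz
  refine (injective_iff_map_eq_zero (Tensor.mapLeft M (freeSyzygyι N))).2 fun x hx => ?_
  obtain ⟨A, ⟨s, rfl⟩, y, rfl⟩ := Tensor.exists_fg_mapRight_subtype x
  rw [Tensor.mapLeft_mapRight] at hx
  have hy := (injective_iff_map_eq_zero _).1
    (Tensor.mapRight_injective_of_free (Submodule.subtype_injective _)) _ hx
  rw [(injective_iff_map_eq_zero _).1 (span s) y hy, map_zero]

end TorOne

/-! ### Relative dimension as vanishing of torsion, and the global dimension. -/

section Resolution

variable {R : Type u} [Ring R]

/-- The resolution of `M` by free modules on the underlying sets of the syzygies. -/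
noncomputable def freeRes (M : ModuleCat.{u} R) : ProjRes M where
  P k := ModuleCat.of R (iterFreeSyzygy M k →₀ R)
  d k := freeSyzygyι (iterFreeSyzygy M k) ∘ₗ freeCover (iterFreeSyzygy M (k + 1))
  aug := freeCover M
  projective k := inferInstanceAs (Module.Projective R (iterFreeSyzygy M k →₀ R))
  aug_surjective := freeCover_surjective M
  exact_aug := (freeCover_surjective (freeSyzygy M)).comp_exact_iff_exact.2
    (exact_freeSyzygyι_freeCover M)
  exact_d k :=
    (freeCover_surjective (freeSyzygy (iterFreeSyzygy M (k + 1)))).comp_exact_iff_exact.2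
      ((freeSyzygyι_injective (iterFreeSyzygy M k)).comp_exact_iff_exact.2
        (exact_freeSyzygyι_freeCover (iterFreeSyzygy M (k + 1))))

theorem ProjRes.exists_exact_syzygy {M : ModuleCat.{u} R} (Q : ProjRes M) (k : ℕ) :
    ∃ (f : Q.syzygy (k + 1) →ₗ[R] Q.P k) (g : Q.P k →ₗ[R] Q.syzygy k),
      Function.Injective f ∧ Function.Exact f g ∧ Function.Surjective g := by
  -- By exactness, each differential corestricts to a surjection onto the kernel of the next map.
  have key : ∀ {A B C : ModuleCat.{u} R} (d : A →ₗ[R] B) (e : B →ₗ[R] C) (h : Function.Exact d e),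
      Function.Exact (LinearMap.ker d).subtype
        (d.codRestrict (LinearMap.ker e) fun x =>
          LinearMap.mem_ker.2 (h.apply_apply_eq_zero x)) ∧
      Function.Surjective (d.codRestrict (LinearMap.ker e) fun x =>
        LinearMap.mem_ker.2 (h.apply_apply_eq_zero x)) := by
    intro A B C d e h
    refine ⟨fun x => ?_, fun ⟨y, hy⟩ => ?_⟩
    · exact Subtype.ext_iff.trans (LinearMap.exact_subtype_ker_map d x)
    · obtain ⟨x, rfl⟩ := (h y).1 hy
      exact ⟨x, rfl⟩
  match k with
  | 0 =>
    exact ⟨(LinearMap.ker Q.aug).subtype, Q.aug, Submodule.subtype_injective _,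
      LinearMap.exact_subtype_ker_map _, Q.aug_surjective⟩
  | 1 => exact ⟨(LinearMap.ker (Q.d 0)).subtype, _, Submodule.subtype_injective _,
      key _ _ Q.exact_aug⟩
  | k + 2 => exact ⟨(LinearMap.ker (Q.d (k + 1))).subtype, _, Submodule.subtype_injective _,
      key _ _ (Q.exact_d k)⟩

/-- Each dimension shift trades one syzygy of `M` for one of `N`; the right side no longer depends
on `Q`. -/
theorem ProjRes.torOneVanishes_syzygy_iff {M : ModuleCat.{u} R} (Q : ProjRes M)
    (N : ModuleCat.{u} Rᵐᵒᵖ) (k : ℕ) :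
    TorOneVanishes N (Q.syzygy k) ↔ TorOneVanishes (iterFreeSyzygy N k) M := by
  have step : ∀ (N : ModuleCat.{u} Rᵐᵒᵖ) k, TorOneVanishes N (Q.syzygy (k + 1)) ↔
      TorOneVanishes (freeSyzygy N) (Q.syzygy k) := by
    intro N k
    obtain ⟨f, g, hf, hfg, hg⟩ := Q.exists_exact_syzygy k
    have := Q.projective k
    exact (torOneVanishes_freeSyzygy_iff N hf hfg hg).symm
  have iter : ∀ j k, TorOneVanishes (iterFreeSyzygy N j) (Q.syzygy k) ↔
      TorOneVanishes (iterFreeSyzygy N (j + k)) M := by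
    intro j k
    induction k generalizing j with
    | zero => exact Iff.rfl
    | succ k ih =>
      rw [step, ← Nat.add_assoc, Nat.add_right_comm]
      exact ih (j + 1)
  have h := iter 0 k
  rwa [Nat.zero_add] at h

/-- The product of a family of right modules. -/
def piModule (R : Type u) [Ring R] {ι : Type u} (F : ι → Type u)
    [∀ i, AddCommGroup (F i)] [∀ i, Module Rᵐᵒᵖ (F i)] :
    ModuleCat.{u} Rᵐᵒᵖ :=
  ModuleCat.of Rᵐᵒᵖ (∀ i, F i)

/-- The vanishing of the torsion of `M` in degree `n + 1` with all products of flat modules. -/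
def TorPiFlatVanishes (R : Type u) [Ring R] (n : ℕ) (M : Type u) [AddCommGroup M]
    [Module R M] : Prop :=
  ∀ (ι : Type u) (F : ι → Type u) [∀ i, AddCommGroup (F i)] [∀ i, Module Rᵐᵒᵖ (F i)],
    (∀ i, IsFlatRight R (F i)) → TorOneVanishes (iterFreeSyzygy (piModule R F) n) M

theorem flatMittagLeffler_iff {K P M : ModuleCat.{u} R} [Module.Projective R P] {f : K →ₗ[R] P}
    {g : P →ₗ[R] M} (hf : Function.Injective f) (hfg : Function.Exact f g)
    (hg : Function.Surjective g) : flatMittagLeffler R K ↔ TorPiFlatVanishes R 0 M := by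
  unfold flatMittagLeffler TorPiFlatVanishes
  refine forall_congr' fun ι => forall_congr' fun F => forall_congr' fun _ =>
    forall_congr' fun _ => forall_congr' fun hF => ?_
  exact (Tensor.piMap_injective_iff F f fun i => hF i _ _ f hf).trans
    (torOneVanishes_iff (piModule R F) hf hfg hg).symm

theorem ProjRes.flatMittagLeffler_syzygy_succ_iff {M : ModuleCat.{u} R} (Q : ProjRes M) (n : ℕ) :
    flatMittagLeffler R (Q.syzygy (n + 1)) ↔ TorPiFlatVanishes R n M := by
  obtain ⟨f, g, hf, hfg, hg⟩ := Q.exists_exact_syzygy n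
  have := Q.projective n
  rw [flatMittagLeffler_iff hf hfg hg]
  refine forall_congr' fun ι => forall_congr' fun F => forall_congr' fun _ =>
    forall_congr' fun _ => forall_congr' fun hF => ?_
  exact Q.torOneVanishes_syzygy_iff (piModule R F) n

theorem hasRelProjDimLE_zero_iff {M : ModuleCat.{u} R} :
    HasRelProjDimLE (flatMittagLeffler R) M 0 ↔ flatMittagLeffler R M :=
  ⟨fun ⟨_, h⟩ => h, fun h => ⟨freeRes M, h⟩⟩

theorem hasRelProjDimLE_succ_iff {M : ModuleCat.{u} R} {n : ℕ} :
    HasRelProjDimLE (flatMittagLeffler R) M (n + 1) ↔ TorPiFlatVanishes R n M :=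
  ⟨fun ⟨Q, h⟩ => (Q.flatMittagLeffler_syzygy_succ_iff n).1 h,
    fun h => ⟨freeRes M, ((freeRes M).flatMittagLeffler_syzygy_succ_iff n).2 h⟩⟩

/-- `I` is a first syzygy of `R ⧸ I`, which accounts for the drop from `n` to `n - 1` in the third
condition. -/
theorem hasRelProjDimLE_ideal_iff (I : Ideal R) (n : ℕ) :
    HasRelProjDimLE (flatMittagLeffler R) (ModuleCat.of R I) n ↔
      TorPiFlatVanishes R n (R ⧸ I) := by
  have hf := Submodule.subtype_injective I
  have hfg := LinearMap.exact_subtype_mkQ I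
  have hg := Submodule.mkQ_surjective I
  cases n with
  | zero =>
    rw [hasRelProjDimLE_zero_iff]
    exact flatMittagLeffler_iff (K := ModuleCat.of R I) (P := ModuleCat.of R R)
      (M := ModuleCat.of R (R ⧸ I)) hf hfg hg
  | succ n =>
    rw [hasRelProjDimLE_succ_iff]
    refine forall_congr' fun ι => forall_congr' fun F => forall_congr' fun _ =>
      forall_congr' fun _ => forall_congr' fun hF => ?_
    exact (torOneVanishes_freeSyzygy_iff _ hf hfg hg).symm

theorem HasRelProjDimLE.of_leftInverse {M M' : ModuleCat.{u} R} {s : M →ₗ[R] M'}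
    {t : M' →ₗ[R] M} (hst : t ∘ₗ s = LinearMap.id) {n : ℕ}
    (h : HasRelProjDimLE (flatMittagLeffler R) M' n) :
    HasRelProjDimLE (flatMittagLeffler R) M n := by
  cases n with
  | zero =>
    rw [hasRelProjDimLE_zero_iff] at h ⊢
    exact fun ι F _ _ hF => Tensor.piMap_injective_of_leftInverse F hst (h ι F hF)
  | succ n =>
    rw [hasRelProjDimLE_succ_iff] at h ⊢
    exact fun ι F _ _ hF => (h ι F hF).of_leftInverse hst

/-- The bound on all modules is applied to syzygies: from 0 to 1 the syzygy is Mittag-Leffler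
because every module is, and later steps shift dimension. -/
theorem hasRelProjDimLE_of_le {k n : ℕ} (hkn : k ≤ n)
    (h : ∀ M : ModuleCat.{u} R, HasRelProjDimLE (flatMittagLeffler R) M k)
    (M : ModuleCat.{u} R) : HasRelProjDimLE (flatMittagLeffler R) M n := by
  induction n, hkn using Nat.le_induction generalizing M with
  | base => exact h M
  | succ n _ ih =>
    cases n with
    | zero => exact ⟨freeRes M, hasRelProjDimLE_zero_iff.1 (ih _)⟩
    | succ n =>
      rw [hasRelProjDimLE_succ_iff]
      intro ι F _ _ hF
      exact (torOneVanishes_freeSyzygy_iff _ (freeSyzygyι_injective M)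
        (exact_freeSyzygyι_freeCover M) (freeCover_surjective M)).2
        (hasRelProjDimLE_succ_iff.1 (ih (freeSyzygy M)) ι F hF)

theorem exists_hasRelProjDimLE_of_relProjDim_le {X : ModuleCat.{u} R → Prop} {M : ModuleCat.{u} R}
    {n : ℕ} (h : relProjDim X M ≤ n) : ∃ k ≤ n, HasRelProjDimLE X M k := by
  by_contra! hk
  have : ((n + 1 : ℕ) : ℕ∞) ≤ relProjDim X M := by
    refine le_iInf₂ fun k hX => Nat.cast_le.2 ?_
    by_contra hlt
    exact hk k (by omega) hX
  have := Nat.cast_le.1 (this.trans h)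
  omega

/-- If every `k ≤ n` failed for some `A k`, the product of the `A k` would still satisfy the bound
for some `k ≤ n`, and so would its direct summand `A k`. -/
theorem hasRelProjDimLE_of_relGlobalDim_le {n : ℕ}
    (h : relGlobalDim R (flatMittagLeffler R) ≤ n) (M : ModuleCat.{u} R) :
    HasRelProjDimLE (flatMittagLeffler R) M n := by
  suffices ∃ k ≤ n, ∀ M : ModuleCat.{u} R, HasRelProjDimLE (flatMittagLeffler R) M k by
    obtain ⟨k, hk, hM⟩ := this
    exact hasRelProjDimLE_of_le hk hM M
  by_contra! hne
  have hne' : ∀ k : Fin (n + 1), ∃ M : ModuleCat.{u} R,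
      ¬ HasRelProjDimLE (flatMittagLeffler R) M k := fun k => hne k (by omega)
  choose A hA using hne'
  obtain ⟨k, hk, hX⟩ := exists_hasRelProjDimLE_of_relProjDim_le
    ((le_iSup (relProjDim (flatMittagLeffler R)) (ModuleCat.of R (∀ k, A k))).trans h)
  refine hA ⟨k, by omega⟩ (hX.of_leftInverse (s := LinearMap.single R (fun k => A k) _)
    (t := LinearMap.proj (φ := fun k => A k) _) ?_)
  ext x
  simp

end Resolution

end RelDim

theorem corollaryc (R : Type u) [Ring R] (n : ℕ) (hn : n ≠ 0) :
    List.TFAE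
      [RelDim.relGlobalDim R (RelDim.flatMittagLeffler R) ≤ (n : ℕ∞),
        ∀ M : ModuleCat.{u} R, RelDim.HasRelProjDimLE (RelDim.flatMittagLeffler R) M n,
        ∀ I : Ideal R, I.FG →
          RelDim.HasRelProjDimLE (RelDim.flatMittagLeffler R) (ModuleCat.of R I) (n - 1)] := by
  -- From here `n` is the predecessor of the original bound, so the third condition concerns
  -- dimension at most `n`.
  obtain ⟨n, rfl⟩ := Nat.exists_eq_succ_of_ne_zero hn
  tfae_have 1 → 2 := RelDim.hasRelProjDimLE_of_relGlobalDim_le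
  tfae_have 2 → 1 := fun h => iSup_le fun M => iInf₂_le _ (h M)
  tfae_have 2 → 3 := fun h I _ => (RelDim.hasRelProjDimLE_ideal_iff I n).2
    (RelDim.hasRelProjDimLE_succ_iff.1 (h (ModuleCat.of R (R ⧸ I))))
  tfae_have 3 → 2 := fun h M => RelDim.hasRelProjDimLE_succ_iff.2 fun ι F _ _ hF =>
    RelDim.torOneVanishes_of_forall_fg
      (fun I hI => (RelDim.hasRelProjDimLE_ideal_iff I n).1 (h I hI) ι F hF) M
  tfae_finish
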